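/- Let $S^2=\{x\in\mathbb R^3:\|x\|_2=1\}$ carry the surface measure $\sigma$ (so that $\sigma(S^2)=4\pi$). A spherical harmonic of degree $n$ is the restriction to $S^2$ of a homogeneous polynomial of degree $n$ in three variables, with complex coefficients, whose Laplacian vanishes. Let $N\ge 0$ be an integer and let $Y_{n,k}$ $(0\le n\le N,\ -n\le k\le n)$ be an orthonormal system in $L^2(S^2,\sigma)$ in which each $Y_{n,k}$ is a spherical harmonic of degree $n$. Let $\mathcal X\subset S^2$ be a finite set and let $w_x\in\mathbb R$ $(x\in\mathcal X)$ be weights such that $$\sum_{x\in\mathcal X} w_x f(x)=\int_{S^2} f\,d\sigma$$ for every spherical harmonic $f$ of degree at most $2N$. Let $\lambda>0$ and let $\hat w_0,\dots,\hat w_N\ge 0$. Put $\boldsymbol F=[Y_{n,k}(x)]_{x\in\mathcal X;\,0\le n\le N,\,-n\le k\le n}$, $\boldsymbol W=\operatorname{diag}(w_x)_{x\in\mathcal X}$ and $\hat{\boldsymbol W}=\operatorname{diag}(\hat w_{n,k})$ with $\hat w_{n,k}=\hat w_n$. Then the matrix $\boldsymbol F^{\mathsf H}\boldsymbol W\boldsymbol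 F+\lambda\hat{\boldsymbol W}$ is invertible, and for every $x\in\mathcal X$ the diagonal entry $h_{x,x}$ of the hat matrix $$\boldsymbol H=\boldsymbol F\left(\boldsymbol F^{\mathsf H}\boldsymbol W\boldsymbol F+\lambda\hat{\boldsymbol W}\right)^{-1}\boldsymbol F^{\mathsf H}\boldsymbol W$$ is $$h_{x,x}=\frac{w_x}{4\pi}\sum_{n=0}^N\frac{2n+1}{1+\lambda\hat w_n}.$$ -/

import Mathlib

open MeasureTheory Matrix

noncomputable section

/-- The unit sphere `S²` in Euclidean three-space. -/
abbrev S2 : Type := Metric.sphere (0 : EuclideanSpace ℝ (Fin 3)) 1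

/-- The surface measure on `S²`, of total mass `4π`. -/
def surfaceMeasure : Measure S2 :=
  (volume : Measure (EuclideanSpace ℝ (Fin 3))).toSphere

/-- The spherical harmonics of degree `n`: the restrictions to `S²` of the homogeneous
polynomials of degree `n` in three variables whose Laplacian vanishes. -/
def sphericalHarmonics (n : ℕ) : Set (S2 → ℂ) :=
  {f | ∃ p : MvPolynomial (Fin 3) ℂ, p.IsHomogeneous n ∧
    ∑ i : Fin 3, MvPolynomial.pderiv i (MvPolynomial.pderiv i p) = 0 ∧
    ∀ x : S2, f x = MvPolynomial.eval (fun i => ((x.1 i : ℝ) : ℂ)) p}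

/-- The index set of all pairs `(n, k)` with `0 ≤ n ≤ N` and `-n ≤ k ≤ n`. -/
abbrev FreqIndex (N : ℕ) : Type :=
  Σ n : Fin (N + 1), ↥(Finset.Icc (-((n : ℕ) : ℤ)) ((n : ℕ) : ℤ))

/-- `Y n k`, for `0 ≤ n ≤ N` and `-n ≤ k ≤ n`, is an `L²(S²)`-orthonormal system in which
`Y n k` is a spherical harmonic of degree `n`. -/
structure IsOrthonormalHarmonicSystem (N : ℕ) (Y : FreqIndex N → S2 → ℂ) : Prop where
  harmonic : ∀ i : FreqIndex N, Y i ∈ sphericalHarmonics (i.1 : ℕ)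
  orthonormal : ∀ i j : FreqIndex N,
    ∫ x, Y i x * (starRingEnd ℂ) (Y j x) ∂surfaceMeasure = if i = j then 1 else 0

/-- The finite node set `X` with real weights `w` is an exact quadrature rule for the class `P`
of integrable functions on `(M, μ)`. -/
def IsExactQuadrature {M : Type*} [MeasurableSpace M] (μ : Measure M) (P : Set (M → ℂ))
    (X : Finset M) (w : X → ℝ) : Prop :=
  ∀ f ∈ P, ∑ x : X, (w x : ℂ) * f x = ∫ x, f x ∂μ

/-- The Fourier matrix `F = [φ_i(x)]`, rows indexed by the nodes, columns by the frequencies. -/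
def fourierMatrix {M ι : Type*} (X : Finset M) (φ : ι → M → ℂ) : Matrix X ι ℂ :=
  Matrix.of fun x i => φ i x

/-- The normal matrix `A = Fᴴ W F + λ Ŵ`, where `W = diag(w)` and `Ŵ = diag(ŵ)`. -/
def normalMatrix {M ι : Type*} [DecidableEq M] [DecidableEq ι] (X : Finset M)
    (φ : ι → M → ℂ) (w : X → ℝ) (lam : ℝ) (wHat : ι → ℝ) : Matrix ι ι ℂ :=
  (fourierMatrix X φ)ᴴ * Matrix.diagonal (fun x => (w x : ℂ)) * fourierMatrix X φ
    + (lam : ℂ) • Matrix.diagonal (fun i => (wHat i : ℂ))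

/-- The hat matrix `H = F (Fᴴ W F + λ Ŵ)⁻¹ Fᴴ W`. -/
def hatMatrix {M ι : Type*} [DecidableEq M] [Fintype ι] [DecidableEq ι] (X : Finset M)
    (φ : ι → M → ℂ) (w : X → ℝ) (lam : ℝ) (wHat : ι → ℝ) : Matrix X X ℂ :=
  fourierMatrix X φ * (normalMatrix X φ w lam wHat)⁻¹ * (fourierMatrix X φ)ᴴ
    * Matrix.diagonal (fun x => (w x : ℂ))

end

/-! Exactness up to degree `2 * N` makes the discrete inner product agree with that of L² on
products of two harmonics of degree at most `N`, so Fᴴ W F = 1. The normal matrix is then diagonal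
with entries 1 + λŵₙ > 0, and h_{x,x} is w_x times the sum over n of (1 + λŵₙ)⁻¹ ∑ₖ |Y_{n,k}(x)|².

Two facts carry this. A product of harmonics is not harmonic, but Fischer's decomposition
(`homogeneousSubmodule_le_fischerSpan`) writes it as a sum of terms |x|^{2j} h with h harmonic, and
|x|² = 1 on the sphere (`quadrature_mul_conj`).

The inner sum is (2n+1)/4π (`sum_mul_conj_eq`): the harmonics of degree n form a rotation-invariant
space of dimension at most 2n+1, so an isometry acts on the Y_{n,k} by a unitary matrix. Hence the
sum is constant on the sphere, and integrating it gives its value. -/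

noncomputable section

namespace SphericalHarmonic

open MvPolynomial

/-! ### Harmonic polynomials and Fischer's decomposition -/

/-- The Laplacian on polynomials in three variables. -/
def laplacian : MvPolynomial (Fin 3) ℂ →ₗ[ℂ] MvPolynomial (Fin 3) ℂ :=
  ∑ i : Fin 3, (pderiv i).toLinearMap ∘ₗ (pderiv i).toLinearMap

theorem laplacian_apply (p : MvPolynomial (Fin 3) ℂ) :
    laplacian p = ∑ i : Fin 3, pderiv i (pderiv i p) := by
  simp [laplacian]

/-- The polynomial `X₀² + X₁² + X₂²`. -/
def normSq : MvPolynomial (Fin 3) ℂ := ∑ i : Fin 3, X i ^ 2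

theorem isHomogeneous_normSq : normSq.IsHomogeneous 2 :=
  IsHomogeneous.sum _ _ _ fun i _ => isHomogeneous_X_pow i 2

/-- The space of harmonic homogeneous polynomials of degree `n`. -/
def harmonicPoly (n : ℕ) : Submodule ℂ (MvPolynomial (Fin 3) ℂ) :=
  homogeneousSubmodule (Fin 3) ℂ n ⊓ LinearMap.ker laplacian

theorem mem_harmonicPoly {n : ℕ} {p : MvPolynomial (Fin 3) ℂ} :
    p ∈ harmonicPoly n ↔ p.IsHomogeneous n ∧ laplacian p = 0 := by
  simp [harmonicPoly]

theorem pderiv_normSq (i : Fin 3) : pderiv i normSq = 2 * X i := by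
  simp only [normSq, map_sum, pderiv_pow]
  rw [Finset.sum_eq_single i]
  · simp
  · intro j _ hj
    simp [pderiv_X_of_ne hj]
  · simp

/-- Product rule: 6 is the Laplacian of |x|², and the cross terms 4 xᵢ ∂ᵢp add up to 4n p by Euler's
identity. -/
theorem laplacian_normSq_mul {n : ℕ} {p : MvPolynomial (Fin 3) ℂ} (hp : p.IsHomogeneous n) :
    laplacian (normSq * p) = (6 + 4 * n : ℂ) • p + normSq * laplacian p := by
  have euler := hp.sum_X_mul_pderiv
  have key (i : Fin 3) : pderiv i (pderiv i (normSq * p)) =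
      2 * p + 4 * (X i * pderiv i p) + normSq * pderiv i (pderiv i p) := by
    have h2 : pderiv i (2 : MvPolynomial (Fin 3) ℂ) = 0 := by
      rw [← map_ofNat C 2, pderiv_C]
    simp only [pderiv_mul, pderiv_normSq, map_add, h2, pderiv_X_self]
    ring
  simp only [laplacian_apply, key, Finset.sum_add_distrib, ← Finset.mul_sum, euler]
  simp only [Finset.sum_const, Finset.card_univ, Fintype.card_fin, MvPolynomial.smul_eq_C_mul,
    nsmul_eq_mul, map_add, map_mul, map_ofNat, map_natCast]
  push_cast
  ring

theorem laplacian_normSq_pow_mul {n : ℕ} {p : MvPolynomial (Fin 3) ℂ} (hp : p ∈ harmonicPoly n)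
    (j : ℕ) : laplacian (normSq ^ (j + 1) * p) =
      (2 * (j + 1) * (2 * j + 3 + 2 * n) : ℂ) • (normSq ^ j * p) := by
  obtain ⟨hp, hl⟩ := mem_harmonicPoly.1 hp
  induction j with
  | zero =>
    simp only [zero_add, pow_one, laplacian_normSq_mul hp, hl, mul_zero, add_zero, pow_zero,
      one_mul]
    congr 1
    push_cast
    ring
  | succ j ih =>
    rw [pow_succ', mul_assoc, laplacian_normSq_mul ((isHomogeneous_normSq.pow (j + 1)).mul hp), ih,
      mul_smul_comm, ← mul_assoc, ← pow_succ', ← add_smul]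
    congr 1
    push_cast
    ring

/-- The span of the products `normSq ^ j * h` with `h` harmonic, in total degree `n`. -/
def fischerSpan (n : ℕ) : Submodule ℂ (MvPolynomial (Fin 3) ℂ) :=
  Submodule.span ℂ {p | ∃ j m h, 2 * j + m = n ∧ h ∈ harmonicPoly m ∧ p = normSq ^ j * h}

theorem fischerSpan_le (n : ℕ) : fischerSpan n ≤ homogeneousSubmodule (Fin 3) ℂ n := by
  refine Submodule.span_le.2 ?_
  rintro _ ⟨j, m, h, rfl, hh, rfl⟩
  exact (isHomogeneous_normSq.pow j).mul (mem_harmonicPoly.1 hh).1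

theorem harmonicPoly_le_fischerSpan (n : ℕ) : harmonicPoly n ≤ fischerSpan n :=
  fun p hp => Submodule.subset_span ⟨0, n, p, by simp, hp, by simp⟩

/-- Each generator |x|^{2j} h is a nonzero multiple of the Laplacian of |x|^{2j+2} h. -/
theorem fischerSpan_le_map_laplacian (n : ℕ) :
    fischerSpan n ≤ (fischerSpan (n + 2)).map laplacian := by
  refine Submodule.span_le.2 ?_
  rintro _ ⟨j, m, h, rfl, hh, rfl⟩
  have hc : (2 * (j + 1) * (2 * j + 3 + 2 * m) : ℂ) ≠ 0 := by
    norm_cast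
    positivity
  refine ⟨(2 * (j + 1) * (2 * j + 3 + 2 * m) : ℂ)⁻¹ • (normSq ^ (j + 1) * h),
    Submodule.smul_mem _ _ (Submodule.subset_span ⟨j + 1, m, h, by ring, hh, rfl⟩), ?_⟩
  rw [map_smul, laplacian_normSq_pow_mul hh, inv_smul_smul₀ hc]

theorem isHomogeneous_laplacian {n : ℕ} {p : MvPolynomial (Fin 3) ℂ} (hp : p.IsHomogeneous (n + 2)) :
    (laplacian p).IsHomogeneous n := by
  rw [laplacian_apply]
  exact IsHomogeneous.sum _ _ _ fun i _ => hp.pderiv.pderiv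

theorem laplacian_eq_zero_of_isHomogeneous {n : ℕ} (hn : n ≤ 1) {p : MvPolynomial (Fin 3) ℂ}
    (hp : p.IsHomogeneous n) : laplacian p = 0 := by
  rw [laplacian_apply]
  refine Finset.sum_eq_zero fun i _ => ?_
  have h : (pderiv i p).IsHomogeneous 0 := by
    have := hp.pderiv (i := i)
    rwa [Nat.sub_eq_zero_of_le hn] at this
  rw [(totalDegree_eq_zero_iff_eq_C.1 ((totalDegree_zero_iff_isHomogeneous _).2 h)), pderiv_C]

/-- Fischer's decomposition. -/
theorem homogeneousSubmodule_le_fischerSpan (n : ℕ) :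
    homogeneousSubmodule (Fin 3) ℂ n ≤ fischerSpan n := by
  induction n using Nat.strong_induction_on with
  | _ n ih =>
    intro p hp
    by_cases hn : n ≤ 1
    · exact harmonicPoly_le_fischerSpan n
        (mem_harmonicPoly.2 ⟨hp, laplacian_eq_zero_of_isHomogeneous hn hp⟩)
    · obtain ⟨m, rfl⟩ : ∃ m, n = m + 2 := ⟨n - 2, by omega⟩
      -- By induction the Laplacian of `p` lies in the span two degrees lower, so it has a preimage
      -- `q` in the span; `p - q` is then harmonic.
      obtain ⟨q, hq, hqp⟩ := fischerSpan_le_map_laplacian m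
        (ih m (by omega) (isHomogeneous_laplacian hp))
      have : p - q ∈ harmonicPoly (m + 2) := by
        rw [mem_harmonicPoly, map_sub, hqp, sub_self]
        exact ⟨hp.sub (fischerSpan_le _ hq), rfl⟩
      simpa using Submodule.add_mem _ (harmonicPoly_le_fischerSpan _ this) hq

/-! ### The dimension bound 2n+1 -/

theorem coeff_laplacian (p : MvPolynomial (Fin 3) ℂ) (m : Fin 3 →₀ ℕ) :
    coeff m (laplacian p) =
      ∑ i, coeff (m + Finsupp.single i 2) p * ((m i + 1) * (m i + 2)) := by
  rw [laplacian_apply, coeff_sum]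
  refine Finset.sum_congr rfl fun i _ => ?_
  rw [coeff_pderiv, coeff_pderiv, add_assoc, ← Finsupp.single_add]
  simp
  ring

/-- The exponents of degree `n` in which the last variable has exponent at most one. -/
def lowExponent (n : ℕ) : Fin (n + 1) ⊕ Fin n → Fin 3 →₀ ℕ
  | .inl a => Finsupp.equivFunOnFinite.symm ![a, n - a, 0]
  | .inr a => Finsupp.equivFunOnFinite.symm ![a, n - 1 - a, 1]

theorem exists_lowExponent_eq {m : Fin 3 →₀ ℕ} (hm : m 2 ≤ 1) :
    ∃ s, lowExponent m.degree s = m := by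
  have hd : m.degree = m 0 + m 1 + m 2 := by
    rw [Finsupp.degree_eq_sum, Fin.sum_univ_three]
  obtain h | h : m 2 = 0 ∨ m 2 = 1 := by omega
  · refine ⟨.inl ⟨m 0, by omega⟩, ?_⟩
    ext i
    fin_cases i <;> simp [lowExponent, h, hd]
  · refine ⟨.inr ⟨m 0, by omega⟩, ?_⟩
    ext i
    fin_cases i <;> simp [lowExponent, h, hd]

/-- Reading Δp = 0 at the exponent m' solves for the coefficient at m' + 2e₂ in terms of two
coefficients whose exponent of the last variable is smaller by 2. All coefficients thus follow from
those where that exponent is 0 or 1. -/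
theorem eq_zero_of_coeff_lowExponent_eq_zero {n : ℕ} {p : MvPolynomial (Fin 3) ℂ}
    (hp : p ∈ harmonicPoly n) (h : ∀ s, coeff (lowExponent n s) p = 0) : p = 0 := by
  obtain ⟨hp, hl⟩ := mem_harmonicPoly.1 hp
  suffices H : ∀ k, ∀ m : Fin 3 →₀ ℕ, m 2 = k → coeff m p = 0 by
    ext m
    simpa using H _ m rfl
  intro k
  induction k using Nat.strong_induction_on with
  | _ k ih =>
    intro m hm
    by_cases hd : m.degree = n
    swap
    · exact hp.coeff_eq_zero hd
    by_cases hk : k ≤ 1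
    · obtain ⟨s, hs⟩ := exists_lowExponent_eq (m := m) (by omega)
      subst hd
      rw [← hs]
      exact h s
    · obtain ⟨m', rfl⟩ : ∃ m', m = m' + Finsupp.single 2 2 :=
        ⟨m - Finsupp.single 2 2, (tsub_add_cancel_of_le (by simp; omega)).symm⟩
      simp only [Finsupp.add_apply, Finsupp.single_eq_same] at hm
      have hc := coeff_laplacian p m'
      rw [hl, coeff_zero, Fin.sum_univ_three,
        ih (m' 2) (by omega) (m' + Finsupp.single 0 2) (by simp),
        ih (m' 2) (by omega) (m' + Finsupp.single 1 2) (by simp)] at hc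
      have hne : ((m' 2 + 1) * (m' 2 + 2) : ℂ) ≠ 0 := by norm_cast
      simpa [hne] using hc.symm

/-- The coefficients of a harmonic polynomial that determine it. -/
def lowCoeff (n : ℕ) : harmonicPoly n →ₗ[ℂ] (Fin (n + 1) ⊕ Fin n → ℂ) :=
  (LinearMap.pi fun s => lcoeff ℂ (lowExponent n s)) ∘ₗ (harmonicPoly n).subtype

theorem lowCoeff_injective (n : ℕ) : Function.Injective (lowCoeff n) := by
  refine (injective_iff_map_eq_zero _).2 fun p hp => Subtype.ext ?_
  exact eq_zero_of_coeff_lowExponent_eq_zero p.2 fun s => congrFun hp s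

instance (n : ℕ) : FiniteDimensional ℂ (harmonicPoly n) :=
  FiniteDimensional.of_injective _ (lowCoeff_injective n)

/-- There are (n+1) + n low exponents. The upper bound suffices, since an orthonormal system of 2n+1
harmonics supplies the reverse inequality. -/
theorem finrank_harmonicPoly_le (n : ℕ) : Module.finrank ℂ (harmonicPoly n) ≤ 2 * n + 1 := by
  refine (LinearMap.finrank_le_finrank_of_injective (lowCoeff_injective n)).trans ?_
  simp
  omega

/-! ### Invariance of harmonicity under orthogonal substitutions -/

/-- The substitution of the linear forms given by the rows of a matrix. -/
def linearSubst (A : Matrix (Fin 3) (Fin 3) ℝ) :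
    MvPolynomial (Fin 3) ℂ →ₐ[ℂ] MvPolynomial (Fin 3) ℂ :=
  aeval fun i => ∑ j, C (A i j : ℂ) * X j

theorem isHomogeneous_linearSubst (A : Matrix (Fin 3) (Fin 3) ℝ) {n : ℕ}
    {p : MvPolynomial (Fin 3) ℂ} (hp : p.IsHomogeneous n) :
    (linearSubst A p).IsHomogeneous n := by
  have h (i : Fin 3) : (∑ j, C (A i j : ℂ) * X j : MvPolynomial (Fin 3) ℂ).IsHomogeneous 1 :=
    IsHomogeneous.sum _ _ _ fun j _ => isHomogeneous_C_mul_X _ _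
  rw [← one_mul n]
  exact hp.aeval _ h

theorem eval_linearSubst (A : Matrix (Fin 3) (Fin 3) ℝ) (p : MvPolynomial (Fin 3) ℂ)
    (v : Fin 3 → ℝ) : eval (fun i => (v i : ℂ)) (linearSubst A p) =
      eval (fun i => ((A *ᵥ v) i : ℂ)) p := by
  induction p using MvPolynomial.induction_on with
  | C a => simp [linearSubst, algebraMap_eq]
  | add p q hp hq => simp [hp, hq]
  | mul_X p i hp => simp [hp]; left; simp [linearSubst, Matrix.mulVec, dotProduct]

theorem pderiv_linearSubst (A : Matrix (Fin 3) (Fin 3) ℝ) (p : MvPolynomial (Fin 3) ℂ)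
    (j : Fin 3) : pderiv j (linearSubst A p) =
      ∑ i, C (A i j : ℂ) * linearSubst A (pderiv i p) := by
  induction p using MvPolynomial.induction_on with
  | C a => simp [linearSubst, algebraMap_eq]
  | add p q hp hq => simp [hp, hq, mul_add, Finset.sum_add_distrib]
  | mul_X p k hp =>
    have hX : pderiv j (linearSubst A (X k)) = C (A k j : ℂ) := by
      simp [linearSubst, pderiv_X, Pi.single_apply]
    simp only [map_mul, pderiv_mul, hp, hX, map_add, mul_add, Finset.sum_add_distrib,
      Finset.sum_mul]
    refine congrArg₂ (· + ·) (Finset.sum_congr rfl fun i _ => mul_assoc _ _ _) ?_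
    simp [pderiv_X, Pi.single_apply, apply_ite (linearSubst A), mul_comm]

/-- By the chain rule the second derivatives appear with coefficients ∑ⱼ Aᵢⱼ Aₖⱼ, the entries of `A
* Aᵀ`. -/
theorem laplacian_linearSubst {A : Matrix (Fin 3) (Fin 3) ℝ} (hA : A * Aᵀ = 1)
    (p : MvPolynomial (Fin 3) ℂ) :
    laplacian (linearSubst A p) = linearSubst A (laplacian p) := by
  have hA' (i k : Fin 3) : ∑ j, C (A i j : ℂ) * C (A k j : ℂ) =
      if i = k then (1 : MvPolynomial (Fin 3) ℂ) else 0 := by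
    have := congrFun (congrFun hA i) k
    rw [Matrix.mul_apply, Matrix.one_apply] at this
    simp only [← map_mul, ← map_sum, ← Complex.ofReal_mul, ← Complex.ofReal_sum]
    simp only [Matrix.transpose_apply] at this
    rw [this]
    split_ifs <;> simp
  calc laplacian (linearSubst A p)
      = ∑ j, ∑ i, ∑ k, C (A i j : ℂ) * C (A k j : ℂ) * linearSubst A (pderiv k (pderiv i p)) := by
        simp only [laplacian_apply, pderiv_linearSubst, map_sum, pderiv_C_mul, Finset.mul_sum,
          mul_assoc]
    _ = ∑ i, ∑ k, (∑ j, C (A i j : ℂ) * C (A k j : ℂ)) *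
          linearSubst A (pderiv k (pderiv i p)) := by
        rw [Finset.sum_comm]
        refine Finset.sum_congr rfl fun i _ => ?_
        rw [Finset.sum_comm]
        simp only [Finset.sum_mul]
    _ = linearSubst A (laplacian p) := by
        simp [hA', laplacian_apply]

theorem linearSubst_mem_harmonicPoly {A : Matrix (Fin 3) (Fin 3) ℝ} (hA : A * Aᵀ = 1) {n : ℕ}
    {p : MvPolynomial (Fin 3) ℂ} (hp : p ∈ harmonicPoly n) : linearSubst A p ∈ harmonicPoly n := by
  obtain ⟨hp, hl⟩ := mem_harmonicPoly.1 hp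
  exact mem_harmonicPoly.2 ⟨isHomogeneous_linearSubst A hp,
    by rw [laplacian_linearSubst hA, hl, map_zero]⟩

/-! ### The surface measure and its isometry invariance -/

instance : IsFiniteMeasure surfaceMeasure :=
  inferInstanceAs (IsFiniteMeasure (volume : Measure (EuclideanSpace ℝ (Fin 3))).toSphere)

theorem surfaceMeasure_real_univ : surfaceMeasure.real Set.univ = 4 * Real.pi := by
  rw [surfaceMeasure, Measure.toSphere_real_apply_univ, measureReal_def,
    EuclideanSpace.volume_ball_fin_three]
  have h : 0 ≤ Real.pi * 4 / 3 := by positivity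
  simp only [finrank_euclideanSpace, Fintype.card_fin, ENNReal.ofReal_one, one_pow, one_mul,
    ENNReal.toReal_ofReal h]
  push_cast
  ring

theorem integrable_of_continuous {f : S2 → ℂ} (hf : Continuous f) :
    Integrable f surfaceMeasure :=
  hf.integrable_of_hasCompactSupport (HasCompactSupport.of_compactSpace f)

theorem integrable_mul_conj {f g : S2 → ℂ} (hf : Continuous f) (hg : Continuous g) :
    Integrable (fun x => f x * (starRingEnd ℂ) (g x)) surfaceMeasure :=
  integrable_of_continuous (hf.mul (Complex.continuous_conj.comp hg))

/-- The action of a linear isometry on the sphere. -/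
def sphereMap (R : EuclideanSpace ℝ (Fin 3) ≃ₗᵢ[ℝ] EuclideanSpace ℝ (Fin 3)) (x : S2) : S2 :=
  ⟨R x.1, by simp⟩

theorem continuous_sphereMap (R : EuclideanSpace ℝ (Fin 3) ≃ₗᵢ[ℝ] EuclideanSpace ℝ (Fin 3)) :
    Continuous (sphereMap R) :=
  (R.continuous.comp continuous_subtype_val).subtype_mk _

open scoped Pointwise in
theorem measurePreserving_sphereMap
    (R : EuclideanSpace ℝ (Fin 3) ≃ₗᵢ[ℝ] EuclideanSpace ℝ (Fin 3)) :
    MeasurePreserving (sphereMap R) surfaceMeasure surfaceMeasure := by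
  have hm := (continuous_sphereMap R).measurable
  refine ⟨hm, Measure.ext fun s hs => ?_⟩
  rw [Measure.map_apply hm hs, surfaceMeasure, Measure.toSphere_apply' _ (hm hs),
    Measure.toSphere_apply' _ hs]
  congr 1
  -- The surface measure of a set is a constant times the volume of the cone over it. Taking cones
  -- commutes with `R`, which preserves volume.
  have himage : Set.Ioo (0 : ℝ) 1 • ((↑) '' (sphereMap R ⁻¹' s) : Set (EuclideanSpace ℝ (Fin 3))) =
      R.toMeasurableEquiv ⁻¹' (Set.Ioo (0 : ℝ) 1 • ((↑) '' s)) := by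
    ext v
    simp only [Set.mem_smul, Set.mem_image, Set.mem_preimage]
    constructor
    · rintro ⟨r, hr, _, ⟨x, hx, rfl⟩, rfl⟩
      exact ⟨r, hr, _, ⟨_, hx, rfl⟩, (R.map_smul r x.1).symm⟩
    · rintro ⟨r, hr, _, ⟨x, hx, rfl⟩, h⟩
      refine ⟨r, hr, _, ⟨sphereMap R.symm x, ?_, rfl⟩, ?_⟩
      · have : sphereMap R (sphereMap R.symm x) = x := Subtype.ext (R.apply_symm_apply _)
        rwa [this]
      · apply R.injective
        refine Eq.trans ?_ h
        simp [sphereMap]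
  rw [himage]
  exact MeasurePreserving.measure_preimage_equiv (f := R.toMeasurableEquiv) R.measurePreserving _

theorem integral_comp_sphereMap (R : EuclideanSpace ℝ (Fin 3) ≃ₗᵢ[ℝ] EuclideanSpace ℝ (Fin 3))
    {f : S2 → ℂ} (hf : Continuous f) :
    ∫ x, f (sphereMap R x) ∂surfaceMeasure = ∫ x, f x ∂surfaceMeasure := by
  have hR := measurePreserving_sphereMap R
  rw [← integral_map hR.measurable.aemeasurable hf.aestronglyMeasurable, hR.map_eq]

/-- The reflection in the hyperplane orthogonal to x - y exchanges these two vectors of equal norm.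
-/
theorem exists_sphereMap_eq (x y : S2) : ∃ R, sphereMap R x = y :=
  ⟨_, Subtype.ext (Submodule.reflection_sub (v := x.1) (w := y.1) (by simp))⟩

/-! ### Spherical harmonics as restricted polynomials -/

/-- Restriction of polynomials to the sphere. -/
def restrict : MvPolynomial (Fin 3) ℂ →ₐ[ℂ] (S2 → ℂ) :=
  AlgHom.pi fun x => aeval fun i => ((x.1 i : ℝ) : ℂ)

theorem restrict_apply (p : MvPolynomial (Fin 3) ℂ) (x : S2) :
    restrict p x = eval (fun i => ((x.1 i : ℝ) : ℂ)) p := by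
  simp [restrict, aeval_eq_eval]

theorem continuous_restrict (p : MvPolynomial (Fin 3) ℂ) : Continuous (restrict p) := by
  rw [funext (restrict_apply p)]
  exact (MvPolynomial.continuous_eval p).comp (by fun_prop)

theorem restrict_normSq : restrict normSq = 1 := by
  ext x
  have h : ∑ i, x.1 i ^ 2 = 1 := by
    rw [← EuclideanSpace.real_norm_sq_eq, norm_eq_of_mem_sphere, one_pow]
  rw [restrict_apply]
  simp only [normSq, map_sum, map_pow, eval_X, Pi.one_apply]
  exact_mod_cast h

theorem mem_sphericalHarmonics {n : ℕ} {f : S2 → ℂ} :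
    f ∈ sphericalHarmonics n ↔ ∃ p ∈ harmonicPoly n, restrict p = f := by
  simp only [sphericalHarmonics, Set.mem_ofPred_eq, mem_harmonicPoly, laplacian_apply, and_assoc,
    funext_iff, restrict_apply, eq_comm]

theorem continuous_of_mem_sphericalHarmonics {n : ℕ} {f : S2 → ℂ} (hf : f ∈ sphericalHarmonics n) :
    Continuous f := by
  obtain ⟨p, -, rfl⟩ := mem_sphericalHarmonics.1 hf
  exact continuous_restrict p

theorem comp_sphereMap_mem_sphericalHarmonics {n : ℕ} {f : S2 → ℂ} (hf : f ∈ sphericalHarmonics n)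
    (R : EuclideanSpace ℝ (Fin 3) ≃ₗᵢ[ℝ] EuclideanSpace ℝ (Fin 3)) :
    f ∘ sphereMap R ∈ sphericalHarmonics n := by
  obtain ⟨p, hp, rfl⟩ := mem_sphericalHarmonics.1 hf
  let b := EuclideanSpace.basisFun (Fin 3) ℝ
  let A := R.toMatrix b.toBasis b.toBasis
  have hA : A * Aᵀ = 1 := (Matrix.mem_unitaryGroup_iff.1 (R.toMatrix_mem_unitaryGroup b b) :)
  have hR (x : EuclideanSpace ℝ (Fin 3)) : A *ᵥ (fun i => x i) = fun i => R x i := by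
    exact LinearMap.toMatrix_mulVec_repr b.toBasis b.toBasis R.toLinearMap x
  refine mem_sphericalHarmonics.2 ⟨linearSubst A p, linearSubst_mem_harmonicPoly hA hp, ?_⟩
  ext x
  rw [restrict_apply, eval_linearSubst A p (fun i => x.1 i), hR, Function.comp_apply,
    restrict_apply]
  rfl

/-! ### Quadrature of polynomials and of products of harmonics -/

/-- A quadrature rule that is exact for spherical harmonics is exact for polynomials. -/
theorem quadrature_of_isHomogeneous {X : Finset S2} {w : X → ℝ} {M : ℕ}
    (hquad : ∀ n ≤ M, IsExactQuadrature surfaceMeasure (sphericalHarmonics n) X w)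
    {n : ℕ} (hn : n ≤ M) {p : MvPolynomial (Fin 3) ℂ} (hp : p.IsHomogeneous n) :
    ∑ x : X, (w x : ℂ) * restrict p x = ∫ x, restrict p x ∂surfaceMeasure := by
  have hspan := homogeneousSubmodule_le_fischerSpan n hp
  clear hp
  induction hspan using Submodule.span_induction with
  | mem q hq =>
    obtain ⟨j, m, h, rfl, hh, rfl⟩ := hq
    -- On the sphere the factor |x|^{2j} is 1, which leaves a harmonic of degree m ≤ n, where the
    -- rule is exact.
    have : restrict (normSq ^ j * h) = restrict h := by
      rw [map_mul, map_pow, restrict_normSq, one_pow, one_mul]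
    rw [this]
    exact hquad m (by omega) _ (mem_sphericalHarmonics.2 ⟨h, hh, rfl⟩)
  | zero => simp
  | add p q _ _ hp hq =>
    simp only [map_add, Pi.add_apply, mul_add, Finset.sum_add_distrib]
    rw [integral_add (integrable_of_continuous (continuous_restrict p))
      (integrable_of_continuous (continuous_restrict q)), hp, hq]
  | smul a p _ hp =>
    simp only [map_smul, Pi.smul_apply, smul_eq_mul, mul_left_comm _ a, ← Finset.mul_sum]
    rw [integral_const_mul, hp]

theorem quadrature_mul_conj {X : Finset S2} {w : X → ℝ} {N : ℕ}
    (hquad : ∀ n ≤ 2 * N, IsExactQuadrature surfaceMeasure (sphericalHarmonics n) X w)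
    {m n : ℕ} (hm : m ≤ N) (hn : n ≤ N) {f g : S2 → ℂ} (hf : f ∈ sphericalHarmonics m)
    (hg : g ∈ sphericalHarmonics n) :
    ∑ x : X, (w x : ℂ) * (f x * (starRingEnd ℂ) (g x)) =
      ∫ x, f x * (starRingEnd ℂ) (g x) ∂surfaceMeasure := by
  obtain ⟨p, hp, rfl⟩ := mem_sphericalHarmonics.1 hf
  obtain ⟨q, hq, rfl⟩ := mem_sphericalHarmonics.1 hg
  -- The coordinates are real, so conjugating a value amounts to conjugating the coefficients, which
  -- keeps the integrand polynomial.
  have hconj (x : S2) : (starRingEnd ℂ) (restrict q x) = restrict (map (starRingEnd ℂ) q) x := by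
    have hx : (fun i => ((x.1 i : ℝ) : ℂ)) = fun i => (starRingEnd ℂ) ((x.1 i : ℝ) : ℂ) := by
      simp
    rw [restrict_apply, restrict_apply, ← eval₂_id, eval₂_comp_left, eval_map, RingHom.comp_id]
    exact congrArg (fun v => eval₂ (starRingEnd ℂ) v q) hx.symm
  have h := quadrature_of_isHomogeneous hquad (show m + n ≤ 2 * N by omega)
    ((mem_harmonicPoly.1 hp).1.mul ((mem_harmonicPoly.1 hq).1.map (starRingEnd ℂ)))
  simpa only [hconj, map_mul, Pi.mul_apply] using h

/-! ### The addition theorem on the diagonal -/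

section AdditionTheorem

variable {ι : Type*} [Fintype ι] [DecidableEq ι] {y : ι → S2 → ℂ}

theorem integral_sum_mul_conj (hc : ∀ i, Continuous (y i))
    (ho : ∀ i j, ∫ x, y i x * (starRingEnd ℂ) (y j x) ∂surfaceMeasure = if i = j then 1 else 0)
    (a : ι → ℂ) (j : ι) :
    ∫ x, (∑ i, a i * y i x) * (starRingEnd ℂ) (y j x) ∂surfaceMeasure = a j := by
  have hint (i : ι) : Integrable (fun x => a i * (y i x * (starRingEnd ℂ) (y j x)))
      surfaceMeasure :=
    (integrable_mul_conj (hc i) (hc j)).const_mul _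
  simp only [Finset.sum_mul, mul_assoc]
  rw [integral_finsetSum _ fun i _ => hint i]
  simp [integral_const_mul, ho]

theorem linearIndependent_of_orthonormal (hc : ∀ i, Continuous (y i))
    (ho : ∀ i j, ∫ x, y i x * (starRingEnd ℂ) (y j x) ∂surfaceMeasure = if i = j then 1 else 0) :
    LinearIndependent ℂ y := by
  refine Fintype.linearIndependent_iff.2 fun a ha j => ?_
  rw [← integral_sum_mul_conj hc ho a j]
  have (x : S2) : ∑ i, a i * y i x = 0 := by simpa using congrFun ha x
  simp [this]

/-- The system is 2n+1 independent vectors in a space of dimension at most 2n+1, hence spans it. -/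
theorem exists_eq_sum_of_orthonormal {n : ℕ} (hn : Fintype.card ι = 2 * n + 1)
    (hh : ∀ i, y i ∈ sphericalHarmonics n)
    (ho : ∀ i j, ∫ x, y i x * (starRingEnd ℂ) (y j x) ∂surfaceMeasure = if i = j then 1 else 0)
    {f : S2 → ℂ} (hf : f ∈ sphericalHarmonics n) : ∃ a : ι → ℂ, ∀ x, f x = ∑ i, a i * y i x := by
  let V := (harmonicPoly n).map restrict.toLinearMap
  have hV {g : S2 → ℂ} : g ∈ V ↔ g ∈ sphericalHarmonics n := mem_sphericalHarmonics.symm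
  have hspan : Submodule.span ℂ (Set.range y) = V := by
    refine Submodule.eq_of_le_of_finrank_le ?_ ?_
    · rw [Submodule.span_le]
      rintro _ ⟨i, rfl⟩
      exact hV.2 (hh i)
    · rw [finrank_span_eq_card (linearIndependent_of_orthonormal
        (fun i => continuous_of_mem_sphericalHarmonics (hh i)) ho), hn]
      exact (Submodule.finrank_map_le _ _).trans (finrank_harmonicPoly_le n)
  obtain ⟨a, ha⟩ := (Submodule.mem_span_range_iff_exists_fun ℂ).1 (hspan ▸ hV.2 hf)
  exact ⟨a, fun x => by simp [← ha]⟩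

/-- The rotated functions are again harmonics of degree n, so y ∘ R = U y. Both systems are
orthonormal, so U is unitary and preserves the norm of the vector (yᵢ(x))ᵢ. -/
theorem sum_mul_conj_sphereMap {n : ℕ} (hn : Fintype.card ι = 2 * n + 1)
    (hh : ∀ i, y i ∈ sphericalHarmonics n)
    (ho : ∀ i j, ∫ x, y i x * (starRingEnd ℂ) (y j x) ∂surfaceMeasure = if i = j then 1 else 0)
    (R : EuclideanSpace ℝ (Fin 3) ≃ₗᵢ[ℝ] EuclideanSpace ℝ (Fin 3)) (x : S2) :
    ∑ i, y i (sphereMap R x) * (starRingEnd ℂ) (y i (sphereMap R x)) =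
      ∑ i, y i x * (starRingEnd ℂ) (y i x) := by
  have hc (i : ι) := continuous_of_mem_sphericalHarmonics (hh i)
  choose U hU using fun i =>
    exists_eq_sum_of_orthonormal hn hh ho (comp_sphereMap_mem_sphericalHarmonics (hh i) R)
  have hU' (z : S2) : (fun i => y i (sphereMap R z)) = Matrix.of U *ᵥ fun i => y i z :=
    funext fun i => hU i z
  -- The inner product of yᵢ ∘ R and yⱼ ∘ R is δᵢⱼ by invariance of the measure, and (U Uᴴ)ᵢⱼ by
  -- expansion.
  have hunit : Matrix.of U * (Matrix.of U)ᴴ = 1 := by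
    ext i j
    have hinv := integral_comp_sphereMap R ((hc i).mul (Complex.continuous_conj.comp (hc j)))
    simp only [Pi.mul_apply, Function.comp_apply] at hinv
    have hcont : Continuous fun z => ∑ k, U i k * y k z :=
      continuous_finsetSum _ fun k _ => continuous_const.mul (hc k)
    have hexp (z : S2) : y i (sphereMap R z) * (starRingEnd ℂ) (y j (sphereMap R z)) =
        ∑ l, (starRingEnd ℂ) (U j l) *
          ((∑ k, U i k * y k z) * (starRingEnd ℂ) (y l z)) := by
      rw [show y i (sphereMap R z) = _ from hU i z, show y j (sphereMap R z) = _ from hU j z,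
        map_sum, Finset.mul_sum]
      exact Finset.sum_congr rfl fun l _ => by rw [map_mul]; ring
    rw [Matrix.one_apply, ← ho i j, ← hinv]
    simp only [hexp]
    rw [integral_finsetSum _ fun l _ => (integrable_mul_conj hcont (hc l)).const_mul _]
    simp only [integral_const_mul, integral_sum_mul_conj hc ho, Matrix.mul_apply,
      Matrix.conjTranspose_apply, Matrix.of_apply]
    exact Finset.sum_congr rfl fun l _ => mul_comm _ _
  have hunit' : (Matrix.of U)ᴴ * Matrix.of U = 1 := mul_eq_one_comm.1 hunit
  have hdot (z : S2) : ∑ i, y i z * (starRingEnd ℂ) (y i z) =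
      star (fun i => y i z) ⬝ᵥ fun i => y i z := by
    simp [dotProduct, mul_comm]
  rw [hdot, hdot, hU' x, Matrix.star_mulVec, Matrix.dotProduct_mulVec, Matrix.vecMul_vecMul,
    hunit', Matrix.vecMul_one]

/-- The addition theorem on the diagonal. -/
theorem sum_mul_conj_eq {n : ℕ} (hn : Fintype.card ι = 2 * n + 1)
    (hh : ∀ i, y i ∈ sphericalHarmonics n)
    (ho : ∀ i j, ∫ x, y i x * (starRingEnd ℂ) (y j x) ∂surfaceMeasure = if i = j then 1 else 0)
    (x : S2) : ∑ i, y i x * (starRingEnd ℂ) (y i x) = (2 * n + 1) / (4 * Real.pi) := by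
  have hc (i : ι) := continuous_of_mem_sphericalHarmonics (hh i)
  have hconst (z : S2) : ∑ i, y i z * (starRingEnd ℂ) (y i z) =
      ∑ i, y i x * (starRingEnd ℂ) (y i x) := by
    obtain ⟨R, rfl⟩ := exists_sphereMap_eq x z
    exact sum_mul_conj_sphereMap hn hh ho R x
  -- The integrand is constant on a sphere of area 4π and is a sum of 2n+1 functions |yᵢ|² of
  -- integral 1.
  have hint : ∫ z, ∑ i, y i z * (starRingEnd ℂ) (y i z) ∂surfaceMeasure = 2 * n + 1 := by
    rw [integral_finsetSum _ fun i _ => integrable_mul_conj (hc i) (hc i)]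
    simp [ho, hn]
  simp only [hconst, integral_const, surfaceMeasure_real_univ] at hint
  rw [eq_div_iff (by simp [Real.pi_ne_zero]), ← hint, Complex.real_smul, mul_comm]
  push_cast
  rfl

end AdditionTheorem

/-! ### The normal matrix -/

/-- Entry (i, j) is the quadrature sum of Y_j times the conjugate of Y_i, so exactness turns it into
the L² inner product. -/
theorem conjTranspose_mul_diagonal_mul_fourierMatrix [DecidableEq S2] {N : ℕ}
    {Y : FreqIndex N → S2 → ℂ} (hY : IsOrthonormalHarmonicSystem N Y) {X : Finset S2} {w : X → ℝ}
    (hquad : ∀ n ≤ 2 * N, IsExactQuadrature surfaceMeasure (sphericalHarmonics n) X w) :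
    (fourierMatrix X Y)ᴴ * Matrix.diagonal (fun x => (w x : ℂ)) * fourierMatrix X Y = 1 := by
  ext i j
  have h := quadrature_mul_conj hquad (Nat.lt_succ_iff.1 j.1.2) (Nat.lt_succ_iff.1 i.1.2)
    (hY.harmonic j) (hY.harmonic i)
  rw [hY.orthonormal j i] at h
  simp only [Matrix.one_apply, eq_comm (a := i), ← h, Matrix.mul_apply (M := _ * _),
    Matrix.mul_diagonal]
  refine Finset.sum_congr rfl fun x _ => ?_
  simp only [fourierMatrix, Matrix.conjTranspose_apply, Matrix.of_apply, starRingEnd_apply]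
  ring

theorem normalMatrix_eq_diagonal [DecidableEq S2] {N : ℕ}
    {Y : FreqIndex N → S2 → ℂ} (hY : IsOrthonormalHarmonicSystem N Y) {X : Finset S2} {w : X → ℝ}
    (hquad : ∀ n ≤ 2 * N, IsExactQuadrature surfaceMeasure (sphericalHarmonics n) X w)
    (lam : ℝ) (v : FreqIndex N → ℝ) :
    normalMatrix X Y w lam v = Matrix.diagonal fun i => ((1 + lam * v i : ℝ) : ℂ) := by
  rw [normalMatrix, conjTranspose_mul_diagonal_mul_fourierMatrix hY hquad, ← Matrix.diagonal_one,
    ← Matrix.diagonal_smul, Matrix.diagonal_add]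
  congr 1
  ext i
  simp

theorem sum_freqIndex_mul_conj {N : ℕ} {Y : FreqIndex N → S2 → ℂ}
    (hY : IsOrthonormalHarmonicSystem N Y) (n : Fin (N + 1)) (x : S2) :
    ∑ k, Y ⟨n, k⟩ x * (starRingEnd ℂ) (Y ⟨n, k⟩ x) = (2 * (n : ℕ) + 1) / (4 * Real.pi) := by
  refine sum_mul_conj_eq (y := fun k => Y ⟨n, k⟩) ?_ (fun k => hY.harmonic ⟨n, k⟩)
    (fun k l => ?_) x
  · simp
    omega
  · rw [hY.orthonormal]
    simp

end SphericalHarmonic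

end

open SphericalHarmonic in
theorem theorem5p1 [DecidableEq S2] (N : ℕ) (Y : FreqIndex N → S2 → ℂ)
    (hY : IsOrthonormalHarmonicSystem N Y)
    (X : Finset S2) (w : X → ℝ)
    (hquad : ∀ n ≤ 2 * N, IsExactQuadrature surfaceMeasure (sphericalHarmonics n) X w)
    (lam : ℝ) (hlam : 0 < lam) (wHat : ℕ → ℝ) (hwHat : ∀ n ≤ N, 0 ≤ wHat n) :
    IsUnit (normalMatrix X Y w lam (fun i => wHat i.1)) ∧
    ∀ x : X, hatMatrix X Y w lam (fun i => wHat i.1) x x =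
      (((w x / (4 * Real.pi)) * ∑ n ∈ Finset.range (N + 1),
        (2 * (n : ℝ) + 1) / (1 + lam * wHat n) : ℝ) : ℂ) := by
  have hne (i : FreqIndex N) : ((1 + lam * wHat i.1 : ℝ) : ℂ) ≠ 0 := by
    have := mul_nonneg hlam.le (hwHat i.1 (Nat.lt_succ_iff.1 i.1.2))
    exact_mod_cast (by linarith : (0 : ℝ) < 1 + lam * wHat i.1).ne'
  have hmul : normalMatrix X Y w lam (fun i => wHat i.1) *
      Matrix.diagonal (fun i => ((1 + lam * wHat i.1 : ℝ) : ℂ)⁻¹) = 1 := by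
    rw [normalMatrix_eq_diagonal hY hquad, Matrix.diagonal_mul_diagonal, ← Matrix.diagonal_one]
    congr 1
    ext i
    exact mul_inv_cancel₀ (hne i)
  refine ⟨IsUnit.of_mul_eq_one _ hmul, fun x => ?_⟩
  rw [hatMatrix, Matrix.inv_eq_right_inv hmul, Matrix.mul_diagonal, Matrix.mul_apply]
  simp only [Matrix.mul_diagonal, fourierMatrix, Matrix.conjTranspose_apply, Matrix.of_apply,
    Fintype.sum_sigma]
  -- The diagonal weight depends on n only, so it factors out of the sum over k and the addition
  -- theorem applies degree by degree.
  have hn (n : Fin (N + 1)) :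
      ∑ k, Y ⟨n, k⟩ x * ((1 + lam * wHat n : ℝ) : ℂ)⁻¹ * star (Y ⟨n, k⟩ x) =
        ((1 + lam * wHat n : ℝ) : ℂ)⁻¹ * ((2 * (n : ℕ) + 1) / (4 * Real.pi)) := by
    rw [← sum_freqIndex_mul_conj hY n x, Finset.mul_sum]
    exact Finset.sum_congr rfl fun k _ => by rw [starRingEnd_apply]; ring
  simp only [hn]
  rw [Fin.sum_univ_eq_sum_range (fun n : ℕ =>
    ((1 + lam * wHat n : ℝ) : ℂ)⁻¹ * ((2 * (n : ℂ) + 1) / (4 * Real.pi))) (N + 1), Finset.sum_mul]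
  push_cast
  rw [Finset.mul_sum]
  exact Finset.sum_congr rfl fun n _ => by ring
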